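/- **Theorem.** Let $S$ be any set, let $d\ge 0$ be an integer, and let $\Gamma:S\times S\times\mathbb R^d\to\mathbb R$. The following are equivalent. 1. For all $s_1,s_2\in S$ the function $z\mapsto\Gamma(s_1,s_2,z)$ is continuous, and the function $$K:\big((s_1,x_1),(s_2,x_2)\big)\mapsto\Gamma(s_1,s_2,x_1-x_2)$$ is a positive semidefinite kernel on $S\times\mathbb R^d$, i.e. $K$ is symmetric and $\sum_{i,j=1}^m c_ic_jK(u_i,u_j)\ge 0$ for all $m$, all $u_1,\dots,u_m\in S\times\mathbb R^d$ and all $c_1,\dots,c_m\in\mathbb R$. 2. There exists a family $(\mu_{s_1,s_2})_{s_1,s_2\in S}$ of finite complex Radon measures on $\mathbb R^d$ such that, for all $s_1,s_2\in S$ and all $z\in\mathbb R^d$, $$\Gamma(s_1,s_2,z)=\int_{\mathbb R^d}e^{-2\pi i\,\xi^Tz}\,d\mu_{s_1,s_2}(\xi),$$ and which is a measure-valued positive kernel in the sense that, for all $n$, all $s_1,\dots,s_n\in S$ and all $a_1,\dots,a_n\in\mathbb C$, $$\sum_{k,l=1}^n a_k\bar a_l\,\mu_{s_k,s_l}$$ is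 a positive measure. -/

import Mathlib

open MeasureTheory
open scoped ComplexOrder ComplexConjugate

namespace BochnerPlus

/-- The function `K((s₁, x₁), (s₂, x₂)) = Γ(s₁, s₂, x₁ - x₂)` on `(S × ℝᵈ) × (S × ℝᵈ)`, as a matrix
indexed by the (possibly infinite) set `S × ℝᵈ`. `Matrix.PosSemidef` for such a matrix says that
`K` is symmetric and that all its finite quadratic forms are nonnegative. -/
def kernel {S : Type*} {d : ℕ} (Γ : S → S → EuclideanSpace ℝ (Fin d) → ℝ) :
    Matrix (S × EuclideanSpace ℝ (Fin d)) (S × EuclideanSpace ℝ (Fin d)) ℝ :=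
  Matrix.of fun p q => Γ p.1 q.1 (p.2 - q.2)

/-- A complex Borel measure is a finite Radon measure if its total variation is finite and
regular. -/
def IsFiniteRadon {d : ℕ} (μ : ComplexMeasure (EuclideanSpace ℝ (Fin d))) : Prop :=
  IsFiniteMeasure μ.variation ∧ μ.variation.Regular

/-- The Fourier transform `z ↦ ∫ exp(-2πi ξᵀz) dμ(ξ)` of a complex measure; the integral is
Mathlib's integral against a vector measure, paired through the multiplication of `ℂ`. -/
noncomputable def fourierTransform {d : ℕ} (μ : ComplexMeasure (EuclideanSpace ℝ (Fin d)))
    (z : EuclideanSpace ℝ (Fin d)) : ℂ :=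
  ∫ᵛ ξ, Complex.exp (-(2 * (Real.pi : ℂ) * Complex.I * ((inner ℝ ξ z : ℝ) : ℂ)))
    ∂[ContinuousLinearMap.mul ℝ ℂ; μ]

/-- A family of complex measures is a measure-valued positive kernel if all the complex measures
`∑ₖₗ aₖ āₗ μ(sₖ, sₗ)` are positive, that is, take values in `[0, ∞)` on all Borel sets. -/
def IsPositiveMeasureKernel {S : Type*} {d : ℕ}
    (μ : S → S → ComplexMeasure (EuclideanSpace ℝ (Fin d))) : Prop :=
  ∀ (n : ℕ) (s : Fin n → S) (a : Fin n → ℂ),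
    0 ≤ ∑ k, ∑ l, (a k * conj (a l)) • μ (s k) (s l)

end BochnerPlus

namespace BochnerPlus

open Filter Topology Real FourierTransform

/-! The link between the two conditions is Bochner's theorem, applied to all finite combinations
over `S` at once. If the kernel is positive semidefinite, each `∑ₖₗ aₖ āₗ Γ(sₖ, sₗ, ·)` is a
continuous positive definite function, hence the Fourier transform of a positive finite measure.
Polarization writes a single `Γ(s₁, s₂, ·)` as a combination of four of these, which yields `μ(s₁,
s₂)`. Since a complex measure is determined by its Fourier transform, `∑ₖₗ aₖ āₗ μ(sₖ, sₗ)` is the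
Bochner measure, so it is positive.

Conversely, dominated convergence gives continuity. Approximating the integrals by Riemann sums
turns the quadratic form of the kernel into a sum of values of positive measures on cells, because
`e^{-2πi ξᵀ(x-y)}` splits as a character of `x` times the conjugate one of `y`.

Bochner's theorem itself is proved by Gaussian regularization: the product of `f` with a Gaussian
has a nonnegative, hence integrable, Fourier transform, and inversion exhibits it as a
characteristic function. As the Gaussian flattens, tightness gives a limit measure. -/

/-- A complex-valued function on an additive group is positive definite if all the matrices
`f (xᵢ - xⱼ)` are positive semidefinite. -/
def PositiveDefinite {E : Type*} [AddGroup E] (f : E → ℂ) : Prop :=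
  ∀ (n : ℕ) (x : Fin n → E) (c : Fin n → ℂ), 0 ≤ ∑ i, ∑ j, c i * conj (c j) * f (x i - x j)

/-! ### Positive definite functions: pointwise bounds and integrated positivity -/

namespace PositiveDefinite

section Group

variable {E : Type*} [AddGroup E] {f : E → ℂ}

theorem map_zero_nonneg (hf : PositiveDefinite f) : 0 ≤ f 0 := by
  simpa using hf 1 0 1

theorem quadratic_nonneg (hf : PositiveDefinite f) (x : E) (a b : ℂ) :
    0 ≤ a * conj a * f 0 + a * conj b * f x + (b * conj a * f (-x) + b * conj b * f 0) := by
  simpa [Fin.sum_univ_two] using hf 2 ![x, 0] ![a, b]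

/-- Nonnegative complex numbers are real: coefficients `(1, 1)` make `f x + f (-x)` real, and `(i,
1)` make `i (f x - f (-x))` real. -/
theorem map_neg (hf : PositiveDefinite f) (x : E) : f (-x) = conj (f x) := by
  have h0 := (Complex.nonneg_iff.1 hf.map_zero_nonneg).2
  have h1 := (Complex.nonneg_iff.1 (hf.quadratic_nonneg x 1 1)).2
  have h2 := (Complex.nonneg_iff.1 (hf.quadratic_nonneg x Complex.I 1)).2
  simp at h1 h2
  apply Complex.ext <;> simp <;> linarith

theorem norm_le (hf : PositiveDefinite f) (x : E) : ‖f x‖ ≤ (f 0).re := by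
  have h0 := (Complex.nonneg_iff.1 hf.map_zero_nonneg).1
  by_cases hx : f x = 0
  · simpa [hx] using h0
  have hn : (‖f x‖ : ℂ) ≠ 0 := by simpa using hx
  have key : f x * conj (f x) = (‖f x‖ : ℂ) ^ 2 := by rw [Complex.mul_conj']
  -- This unimodular coefficient rotates both cross terms to `-‖f x‖`.
  have h := (Complex.nonneg_iff.1 (hf.quadratic_nonneg x (-conj (f x) / ‖f x‖) 1)).1
  have e : (-conj (f x) / ‖f x‖) * conj (-conj (f x) / ‖f x‖) * f 0 +
      (-conj (f x) / ‖f x‖) * conj 1 * f x + (1 * conj (-conj (f x) / ‖f x‖) * f (-x) +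
        1 * conj 1 * f 0) = 2 * f 0 - 2 * ‖f x‖ := by
    rw [hf.map_neg]
    simp only [map_div₀, _root_.map_neg, Complex.conj_conj, Complex.conj_ofReal, _root_.map_one]
    field_simp
    linear_combination (f 0 - 2 * (‖f x‖ : ℂ)) * key
  rw [e] at h
  simp at h
  linarith

end Group

section Integral

variable {E : Type*} [NormedAddCommGroup E] [MeasurableSpace E] [BorelSpace E]
  [SecondCountableTopology E] {f : E → ℂ}

/-- Average the quadratic form over `N` independent points; the diagonal terms are negligible. -/
theorem integral_prod_nonneg (hf : PositiveDefinite f) (hc : Continuous f)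
    (P : Measure E) [IsProbabilityMeasure P] {u : E → ℂ} (hu : Measurable u)
    (hu1 : ∀ x, ‖u x‖ ≤ 1) :
    0 ≤ ∫ p, u p.1 * conj (u p.2) * f (p.1 - p.2) ∂(P.prod P) := by
  set h : E × E → ℂ := fun p => u p.1 * conj (u p.2) * f (p.1 - p.2) with hh
  have hm : Measurable h := by
    have : Measurable fun z : ℂ => conj z := Complex.continuous_conj.measurable
    have := hc.measurable
    fun_prop
  have hb : ∀ p, ‖h p‖ ≤ (f 0).re := fun p => by
    simp only [hh, norm_mul, RCLike.norm_conj]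
    calc _ ≤ 1 * 1 * (f 0).re := by
          gcongr
          exacts [hu1 _, hu1 _, hf.norm_le _]
      _ = _ := by ring
  -- Expectation of the quadratic form at `N` independent points of law `P`: `N` diagonal terms and
  -- `N (N - 1)` off-diagonal ones.
  have hN (N : ℕ) : 0 ≤ (N : ℂ) * ∫ x, h (x, x) ∂P +
      (N : ℂ) * (N - 1) * ∫ p, h p ∂(P.prod P) := by
    set Q := Measure.pi fun _ : Fin N => P
    have hint (i j : Fin N) : Integrable (fun ω => h (ω i, ω j)) Q :=
      Integrable.of_bound (hm.comp (by fun_prop)).aestronglyMeasurable _ (ae_of_all _ fun ω => hb _)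
    have h1 : 0 ≤ ∫ ω, ∑ i, ∑ j, h (ω i, ω j) ∂Q :=
      integral_nonneg fun ω => by simpa [hh] using hf N ω fun i => u (ω i)
    rw [integral_finsetSum _ fun i _ => integrable_finsetSum _ fun j _ => hint i j] at h1
    simp_rw [integral_finsetSum _ fun j _ => hint _ j] at h1
    have hij (i j : Fin N) : ∫ ω, h (ω i, ω j) ∂Q =
        (if i = j then ∫ x, h (x, x) ∂P - ∫ p, h p ∂(P.prod P) else 0) +
          ∫ p, h p ∂(P.prod P) := by
      split_ifs with e
      · subst e
        rw [sub_add_cancel]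
        have mp := measurePreserving_eval (fun _ : Fin N => P) i
        have hd : AEStronglyMeasurable (fun x => h (x, x)) P :=
          (hm.comp (by fun_prop)).aestronglyMeasurable
        rw [← mp.map_eq] at hd ⊢
        rw [integral_map mp.measurable.aemeasurable hd]
      · rw [zero_add]
        have ind := (ProbabilityTheory.iIndepFun_pi (μ := fun _ : Fin N => P)
          (X := fun _ => id) fun _ => aemeasurable_id).indepFun e
        simp only [id_eq] at ind
        rw [ProbabilityTheory.indepFun_iff_map_prod_eq_prod_map_map
          (measurable_pi_apply i).aemeasurable (measurable_pi_apply j).aemeasurable] at ind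
        have m (i : Fin N) : Measure.map (fun ω : Fin N → E => ω i) Q = P :=
          (measurePreserving_eval (fun _ : Fin N => P) i).map_eq
        rw [m, m] at ind
        rw [← ind, integral_map
          ((measurable_pi_apply i).prodMk (measurable_pi_apply j)).aemeasurable
          hm.aestronglyMeasurable]
    simp_rw [hij, Finset.sum_add_distrib] at h1
    simp only [Finset.sum_ite_eq, Finset.mem_univ, if_true, Finset.sum_const, Finset.card_univ,
      Fintype.card_fin, nsmul_eq_mul] at h1
    convert h1 using 1
    ring
  set D := ∫ x, h (x, x) ∂P
  set J := ∫ p, h p ∂(P.prod P)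
  -- With `N + 1` points, dividing by `(N + 1)²` leaves `(D - J) / (N + 1) + J`.
  have hlim : Tendsto (fun N : ℕ => ((1 / ((N : ℝ) + 1) : ℝ) : ℂ) * (D - J) + J) atTop
      (𝓝 (((0 : ℝ) : ℂ) * (D - J) + J)) :=
    ((((Complex.continuous_ofReal.tendsto _).comp
      tendsto_one_div_add_atTop_nhds_zero_nat).mul_const _).add_const _)
  simp only [Complex.ofReal_zero, zero_mul, zero_add] at hlim
  refine ge_of_tendsto hlim (Eventually.of_forall fun N => ?_)
  have h2 : (0 : ℂ) ≤ (((1 / ((N : ℝ) + 1)) ^ 2 : ℝ) : ℂ) :=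
    Complex.zero_le_real.2 (by positivity)
  have h3 := mul_nonneg h2 (hN (N + 1))
  convert h3 using 1
  have : (N : ℂ) + 1 ≠ 0 := by exact_mod_cast N.succ_ne_zero
  push_cast
  field_simp
  ring

end Integral

end PositiveDefinite


/-! ### Gaussian regularization and nonnegative Fourier transforms -/

section

variable {E : Type*} [NormedAddCommGroup E] [InnerProductSpace ℝ E] [FiniteDimensional ℝ E]
  [MeasurableSpace E] [BorelSpace E]

theorem integrable_rexp_neg_mul_sq_norm {b : ℝ} (hb : 0 < b) :
    Integrable fun v : E => rexp (-b * ‖v‖ ^ 2) := by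
  have := (GaussianFourier.integrable_cexp_neg_mul_sq_norm_add (V := E) (b := b) (by simpa)
    0 0).norm
  simpa [Complex.norm_exp, ← Complex.ofReal_pow] using this

theorem integral_rexp_neg_mul_sq_norm_pos {b : ℝ} (hb : 0 < b) :
    0 < ∫ v : E, rexp (-b * ‖v‖ ^ 2) := by
  rw [GaussianFourier.integral_rexp_neg_mul_sq_norm hb]
  positivity

/-- Convolving two Gaussians shows that the Fourier transform of a positive definite function
times a Gaussian is a double integral of the kernel `f (x - y)` against a rank one kernel. -/
theorem PositiveDefinite.fourier_mul_gaussian_nonneg {f : E → ℂ} (hf : PositiveDefinite f)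
    (hc : Continuous f) {a : ℝ} (ha : 0 < a) (ξ : E) :
    0 ≤ 𝓕 (fun x => f x * (rexp (-a * ‖x‖ ^ 2) : ℂ)) ξ := by
  -- The exponent `2a` is chosen so that `w (x + y) * w y` is `exp (-a‖x‖²)` times a translate in
  -- `y` of `exp (-4a‖y‖²)`; integrating out `y` leaves the desired Gaussian.
  set w : E → ℝ := fun x => rexp (-(2 * a) * ‖x‖ ^ 2) with hw
  have h2a : 0 < 2 * a := by positivity
  have hwi : Integrable w := integrable_rexp_neg_mul_sq_norm h2a
  set Z := ∫ x, w x with hZ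
  have hZ0 : 0 < Z := integral_rexp_neg_mul_sq_norm_pos h2a
  set q : E → ENNReal := fun x => ENNReal.ofReal (w x / Z) with hq
  have hwm : Measurable w := by fun_prop
  have hqm : Measurable q := by fun_prop
  have hP : IsProbabilityMeasure ((volume : Measure E).withDensity q) := by
    refine ⟨?_⟩
    rw [withDensity_apply _ MeasurableSet.univ, setLIntegral_univ,
      ← ofReal_integral_eq_lintegral_ofReal (hwi.div_const Z)
        (ae_of_all _ fun x => by positivity), integral_div, div_self hZ0.ne']
    simp
  set u : E → ℂ := fun x => (𝐞 (-inner ℝ x ξ) : ℂ) with hu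
  have hcu : Continuous u := by
    have := Real.continuous_fourierChar
    fun_prop
  have key := hf.integral_prod_nonneg hc ((volume : Measure E).withDensity q) (u := u)
    hcu.measurable fun x => (Circle.norm_coe _).le
  rw [prod_withDensity hqm hqm, integral_withDensity_eq_integral_toReal_smul (by fun_prop)
    (ae_of_all _ fun z => by simp [hq, ENNReal.mul_lt_top])] at key
  set G : E × E → ℂ := fun z => (w (z.1 + z.2) * w z.2 / Z ^ 2 : ℝ) * (u z.1 * f z.1) with hG
  have huu (x y : E) : u x * conj (u y) = u (x - y) := by
    simp only [hu]
    rw [← Circle.coe_inv_eq_conj, ← Circle.coe_mul, ← AddChar.map_neg_eq_inv,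
      ← AddChar.map_add_eq_mul, inner_sub_left]
    congr 2
    ring
  -- The shear `(x, y) ↦ (x + y, y)` makes the factor `f (z.1 - z.2)` depend on the first variable
  -- only.
  have mp := measurePreserving_add_prod (volume : Measure E) (volume : Measure E)
  have hF : Continuous fun z : E × E =>
      ((w z.1 * w z.2 / Z ^ 2 : ℝ) : ℂ) * (u (z.1 - z.2) * f (z.1 - z.2)) := by
    fun_prop
  have hFi : Integrable (fun z : E × E =>
      ((w z.1 * w z.2 / Z ^ 2 : ℝ) : ℂ) * (u (z.1 - z.2) * f (z.1 - z.2)))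
      (volume.prod volume) := by
    refine Integrable.mul_bdd (c := (f 0).re) ((hwi.mul_prod hwi).div_const _).ofReal
      (by fun_prop) (ae_of_all _ fun z => ?_)
    rw [norm_mul, hu, Circle.norm_coe, one_mul]
    exact hf.norm_le _
  have hGi : Integrable G (volume.prod volume) := by
    have := mp.integrable_comp_of_integrable hFi
    simpa [Function.comp_def, hG] using this
  have e1 : ∫ z : E × E, (q z.1 * q z.2).toReal • (u z.1 * conj (u z.2) * f (z.1 - z.2))
      ∂(volume.prod volume) = ∫ z, G z ∂(volume.prod volume) := by
    calc _ = ∫ z : E × E, ((w z.1 * w z.2 / Z ^ 2 : ℝ) : ℂ) * (u (z.1 - z.2) * f (z.1 - z.2))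
            ∂(volume.prod volume) := by
          congr 1 with z
          rw [huu, Complex.real_smul]
          congr 2
          rw [ENNReal.toReal_mul, ENNReal.toReal_ofReal (by positivity),
            ENNReal.toReal_ofReal (by positivity)]
          field_simp
      _ = _ := by
          nth_rw 1 [← mp.map_eq]
          rw [integral_map mp.measurable.aemeasurable hF.aestronglyMeasurable]
          simp [hG]
  rw [e1, integral_prod _ hGi] at key
  set C := ∫ y : E, rexp (-(4 * a) * ‖y‖ ^ 2) with hC
  have hC0 : 0 < C := integral_rexp_neg_mul_sq_norm_pos (by positivity)
  have hin (x : E) : ∫ y, G (x, y) = ((C / Z ^ 2 : ℝ) : ℂ) *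
      (u x * (f x * (rexp (-a * ‖x‖ ^ 2) : ℂ))) := by
    have hww (y : E) : w (x + y) * w y =
        rexp (-a * ‖x‖ ^ 2) * rexp (-(4 * a) * ‖y + (2⁻¹ : ℝ) • x‖ ^ 2) := by
      simp only [hw, ← Real.exp_add]
      rw [norm_add_sq_real, norm_add_sq_real, norm_smul, inner_smul_right, real_inner_comm]
      congr 1
      norm_num
      ring
    simp only [hG]
    rw [integral_mul_const, integral_complex_ofReal, integral_div]
    simp_rw [hww]
    rw [integral_const_mul,
      integral_add_right_eq_self (fun y : E => rexp (-(4 * a) * ‖y‖ ^ 2)), ← hC]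
    push_cast
    ring
  simp_rw [hin] at key
  rw [integral_const_mul] at key
  rw [Real.fourier_eq]
  have e2 : ∫ v, u v * (f v * (rexp (-a * ‖v‖ ^ 2) : ℂ)) =
      ∫ v, 𝐞 (-inner ℝ v ξ) • (f v * (rexp (-a * ‖v‖ ^ 2) : ℂ)) := rfl
  rw [e2] at key
  have h3 : (0 : ℂ) ≤ ((Z ^ 2 / C : ℝ) : ℂ) := Complex.zero_le_real.2 (by positivity)
  have h4 := mul_nonneg h3 key
  rwa [← mul_assoc, ← Complex.ofReal_mul, show Z ^ 2 / C * (C / Z ^ 2) = 1 by field_simp,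
    Complex.ofReal_one, one_mul] at h4

/-- An integrable function that is continuous at `0` and has a nonnegative Fourier transform has an
integrable Fourier transform. -/
theorem integrable_fourier_of_nonneg {F : E → ℂ} (hF : Integrable F) (h0 : ContinuousAt F 0)
    (hpos : ∀ ξ, 0 ≤ 𝓕 F ξ) : Integrable (𝓕 F) := by
  have hcF : Continuous (𝓕 F) :=
    VectorFourier.fourierIntegral_continuous Real.continuous_fourierChar continuous_inner hF
  have hre (ξ : E) : 𝓕 F ξ = ((𝓕 F ξ).re : ℂ) := by
    apply Complex.ext
    · simp
    · simpa using (Complex.nonneg_iff.1 (hpos ξ)).2.symm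
  -- Gauss summation: moving the Fourier transform onto the Gaussian turns it into an approximate
  -- identity at `0`.
  have hlim : Tendsto (fun c : ℝ => ∫ w : E, (rexp (-c⁻¹ * ‖w‖ ^ 2) : ℂ) * 𝓕 F w) atTop
      (𝓝 (F 0)) := by
    refine (Real.tendsto_integral_gaussian_smul' hF h0).congr' ?_
    filter_upwards [Ioi_mem_atTop 0] with c (hc : 0 < c)
    have J : Integrable (fun w : E => Complex.exp (- c⁻¹ * ‖w‖ ^ 2)) := by
      simpa using GaussianFourier.integrable_cexp_neg_mul_sq_norm_add (V := E) (b := c⁻¹)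
        (by simpa) 0 0
    have e := VectorFourier.integral_fourierIntegral_smul_eq_flip (L := innerₗ E)
      Real.continuous_fourierChar continuous_inner J hF
    have e' : ∫ w : E, 𝓕 (fun w : E => Complex.exp (- c⁻¹ * ‖w‖ ^ 2)) w • F w =
        ∫ w : E, Complex.exp (- c⁻¹ * ‖w‖ ^ 2) • 𝓕 F w := by
      simpa using! e
    simp only [smul_eq_mul] at e'
    simp only [Complex.ofReal_inv] at e'
    push_cast
    rw [← e']
    congr with w
    rw [fourier_gaussian_innerProductSpace (by simpa)]
    simp [div_inv_eq_mul]
    left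
    ring_nf
    simp
  set g : E → ℝ := fun ξ => (𝓕 F ξ).re with hg
  have hg0 (ξ : E) : 0 ≤ g ξ := (Complex.nonneg_iff.1 (hpos ξ)).1
  have hcg : Continuous g := by fun_prop
  set c : ℕ → ℝ := fun n => (n : ℝ) + 1
  have hc : Tendsto c atTop atTop := tendsto_natCast_atTop_atTop.atTop_add tendsto_const_nhds
  have hc0 (n : ℕ) : 0 < c n := by positivity
  have hgi (n : ℕ) : Integrable fun w : E => rexp (-(c n)⁻¹ * ‖w‖ ^ 2) * g w := by
    refine Integrable.mul_bdd (c := ∫ v, ‖F v‖)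
      (integrable_rexp_neg_mul_sq_norm (inv_pos.2 (hc0 n))) (by fun_prop) (ae_of_all _ fun w => ?_)
    exact (Complex.abs_re_le_norm _).trans
      (VectorFourier.norm_fourierIntegral_le_integral_norm _ _ _ _ _)
  have hlim' : Tendsto (fun n => ∫ w : E, rexp (-(c n)⁻¹ * ‖w‖ ^ 2) * g w) atTop
      (𝓝 (F 0).re) := by
    refine ((Complex.continuous_re.tendsto _).comp (hlim.comp hc)).congr fun n => ?_
    have : ∫ w : E, ((rexp (-(c n)⁻¹ * ‖w‖ ^ 2) : ℝ) : ℂ) * 𝓕 F w =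
        ∫ w : E, ((rexp (-(c n)⁻¹ * ‖w‖ ^ 2) * g w : ℝ) : ℂ) := by
      congr with w
      rw [hre w]
      push_cast
      rfl
    simp only [Function.comp_apply, this, integral_complex_ofReal, Complex.ofReal_re]
  -- Fatou's lemma; nonnegativity turns the summability at `0` into a bound on the full integral.
  have hlint : ∫⁻ w, ENNReal.ofReal (g w) ≤ ENNReal.ofReal (F 0).re := by
    calc ∫⁻ w, ENNReal.ofReal (g w)
        = ∫⁻ w, liminf (fun n => ENNReal.ofReal (rexp (-(c n)⁻¹ * ‖w‖ ^ 2) * g w)) atTop := by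
          congr with w
          refine (Tendsto.liminf_eq ?_).symm
          refine (ENNReal.continuous_ofReal.tendsto _).comp ?_
          have : Tendsto (fun n => rexp (-(c n)⁻¹ * ‖w‖ ^ 2) * g w) atTop
              (𝓝 (rexp (-0 * ‖w‖ ^ 2) * g w)) :=
            ((Real.continuous_exp.tendsto _).comp
              ((tendsto_inv_atTop_zero.comp hc).neg.mul_const _)).mul_const _
          simpa using this
      _ ≤ liminf (fun n => ∫⁻ w, ENNReal.ofReal (rexp (-(c n)⁻¹ * ‖w‖ ^ 2) * g w)) atTop :=
          lintegral_liminf_le fun n => by fun_prop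
      _ = ENNReal.ofReal (F 0).re := by
          refine Tendsto.liminf_eq ?_
          refine ((ENNReal.continuous_ofReal.tendsto _).comp hlim').congr fun n => ?_
          exact ofReal_integral_eq_lintegral_ofReal (hgi n)
            (ae_of_all _ fun w => mul_nonneg (exp_pos _).le (hg0 w))
  have hgint : Integrable g := by
    refine ⟨hcg.aestronglyMeasurable, ?_⟩
    rw [hasFiniteIntegral_iff_ofReal (ae_of_all _ hg0)]
    exact hlint.trans_lt ENNReal.ofReal_lt_top
  exact hgint.ofReal.congr (ae_of_all _ fun w => (hre w).symm)

end


/-! ### Bochner's theorem for finite measures -/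

section

variable {E : Type*} [NormedAddCommGroup E] [InnerProductSpace ℝ E] [FiniteDimensional ℝ E]
  [MeasurableSpace E] [BorelSpace E]

/-- By Fourier inversion, the measure with density `𝓕 F` works; the factor `2π` reconciles the two
normalizations. -/
theorem exists_charFun_eq_of_fourier_nonneg {F : E → ℂ} (hc : Continuous F) (hF : Integrable F)
    (hpos : ∀ ξ, 0 ≤ 𝓕 F ξ) :
    ∃ ν : Measure E, IsFiniteMeasure ν ∧ ∀ x, charFun ν ((2 * π) • x) = F x := by
  have hi := integrable_fourier_of_nonneg hF hc.continuousAt hpos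
  have hcF : Continuous (𝓕 F) :=
    VectorFourier.fourierIntegral_continuous Real.continuous_fourierChar continuous_inner hF
  have hre (ξ : E) : ((𝓕 F ξ).re : ℂ) = 𝓕 F ξ := by
    apply Complex.ext
    · simp
    · simpa using (Complex.nonneg_iff.1 (hpos ξ)).2
  refine ⟨volume.withDensity fun ξ => ENNReal.ofReal (𝓕 F ξ).re,
    isFiniteMeasure_withDensity_ofReal hi.re.2, fun x => ?_⟩
  rw [charFun_apply, integral_withDensity_eq_integral_toReal_smul (by fun_prop)
    (ae_of_all _ fun _ => ENNReal.ofReal_lt_top)]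
  nth_rw 2 [← hc.fourierInv_fourier_eq hF hi]
  rw [Real.fourierInv_eq]
  congr with ξ
  rw [ENNReal.toReal_ofReal (Complex.nonneg_iff.1 (hpos ξ)).1, Circle.smul_def,
    Real.fourierChar_apply, inner_smul_right, Complex.real_smul, hre, mul_comm, smul_eq_mul]

theorem PositiveDefinite.comp_addMonoidHom {G H : Type*} [AddGroup G] [AddGroup H] {f : H → ℂ}
    (hf : PositiveDefinite f) (φ : G →+ H) : PositiveDefinite fun x => f (φ x) := fun n x c => by
  simpa using hf n (fun i => φ (x i)) c

theorem PositiveDefinite.const_mul {G : Type*} [AddGroup G] {f : G → ℂ}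
    (hf : PositiveDefinite f) {r : ℂ} (hr : 0 ≤ r) : PositiveDefinite fun x => r * f x :=
  fun n x c => by
    have := mul_nonneg hr (hf n x c)
    simp only [Finset.mul_sum] at this
    refine this.trans_eq (Finset.sum_congr rfl fun i _ => Finset.sum_congr rfl fun j _ => ?_)
    ring

/-- **Bochner's theorem** for normalized functions. -/
theorem PositiveDefinite.exists_probabilityMeasure {f : E → ℂ} (hf : PositiveDefinite f)
    (hc : Continuous f) (h1 : f 0 = 1) :
    ∃ P : ProbabilityMeasure E, ∀ t, charFun (P : Measure E) t = f t := by
  have hpi : (2 * π) ≠ 0 := by positivity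
  set k : E → ℂ := fun x => f ((2 * π) • x) with hk
  have hkp : PositiveDefinite k :=
    hf.comp_addMonoidHom (DistribSMul.toAddMonoidHom E (2 * π))
  have hkc : Continuous k := by fun_prop
  have hn (n : ℕ) : ∃ ν : Measure E, IsFiniteMeasure ν ∧ ∀ x, charFun ν ((2 * π) • x) =
      k x * (rexp (-(1 / ((n : ℝ) + 1)) * ‖x‖ ^ 2) : ℂ) := by
    have ha : 0 < 1 / ((n : ℝ) + 1) := by positivity
    refine exists_charFun_eq_of_fourier_nonneg (by fun_prop) ?_
      (hkp.fourier_mul_gaussian_nonneg hkc ha)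
    exact (integrable_rexp_neg_mul_sq_norm ha).ofReal.bdd_mul (c := (k 0).re)
      hkc.aestronglyMeasurable (ae_of_all _ hkp.norm_le)
  choose ν hν hνk using hn
  have hprob (n : ℕ) : IsProbabilityMeasure (ν n) := by
    have h := hνk n 0
    simp only [smul_zero, charFun_zero, hk, h1, norm_zero] at h
    refine ⟨?_⟩
    have h' : (ν n).real Set.univ = 1 := by
      have : ((ν n).real Set.univ : ℂ) = 1 := by simpa using h
      exact_mod_cast this
    rwa [measureReal_def, ENNReal.toReal_eq_one_iff] at h'
  have hlim (t : E) : Tendsto (fun n => charFun (ν n) t) atTop (𝓝 (f t)) := by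
    have e (n : ℕ) : charFun (ν n) t =
        f t * (rexp (-(1 / ((n : ℝ) + 1)) * ‖(2 * π)⁻¹ • t‖ ^ 2) : ℂ) := by
      have := hνk n ((2 * π)⁻¹ • t)
      simpa only [hk, smul_inv_smul₀ hpi] using this
    simp_rw [e]
    have : Tendsto (fun n : ℕ => f t *
        (rexp (-(1 / ((n : ℝ) + 1)) * ‖(2 * π)⁻¹ • t‖ ^ 2) : ℂ)) atTop
        (𝓝 (f t * (rexp (-0 * ‖(2 * π)⁻¹ • t‖ ^ 2) : ℂ))) :=
      ((Complex.continuous_ofReal.tendsto _).comp ((Real.continuous_exp.tendsto _).comp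
        (tendsto_one_div_add_atTop_nhds_zero_nat.neg.mul_const _))).const_mul _
    simpa using this
  -- Continuity of the limit `f` at `0` prevents mass from escaping to infinity.
  have htight := isTightMeasureSet_of_tendsto_charFun hc.continuousAt hlim
  set p : ℕ → ProbabilityMeasure E := fun n => ⟨ν n, hprob n⟩
  have hcomp : IsCompact (closure (Set.range p)) := by
    refine isCompact_closure_of_isTightMeasureSet ?_
    convert htight using 1
    ext μ
    constructor
    · rintro ⟨_, ⟨n, rfl⟩, rfl⟩
      exact ⟨n, rfl⟩
    · rintro ⟨n, rfl⟩
      exact ⟨p n, ⟨n, rfl⟩, rfl⟩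
  -- A limit along a free ultrafilter suffices, since the characteristic functions already converge
  -- to `f` pointwise.
  obtain ⟨P, -, hP⟩ := hcomp.ultrafilter_le_nhds ((hyperfilter ℕ : Ultrafilter ℕ).map p)
    (le_principal_iff.2 (mem_of_superset (Filter.range_mem_map) subset_closure))
  have hP' : Tendsto p (hyperfilter ℕ : Filter ℕ) (𝓝 P) := hP
  refine ⟨P, fun t => ?_⟩
  rw [ProbabilityMeasure.tendsto_iff_forall_integral_rclike_tendsto ℂ] at hP'
  have h2 := hP' (BoundedContinuousFunction.innerProbChar t)
  simp_rw [← charFun_eq_integral_innerProbChar] at h2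
  exact tendsto_nhds_unique h2 ((hlim t).mono_left Nat.hyperfilter_le_atTop)

/-- **Bochner's theorem**: a continuous positive definite function on a finite-dimensional inner
product space is the characteristic function of a finite measure. -/
theorem PositiveDefinite.exists_charFun_eq {f : E → ℂ} (hf : PositiveDefinite f)
    (hc : Continuous f) :
    ∃ ν : Measure E, IsFiniteMeasure ν ∧ ∀ t, charFun ν t = f t := by
  have h0 := hf.map_zero_nonneg
  obtain ⟨r, hr, hr0⟩ : ∃ r : NNReal, f 0 = (r : ℝ) ∧ (f 0).re = r :=
    ⟨⟨(f 0).re, (Complex.nonneg_iff.1 h0).1⟩,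
      Complex.ext rfl (by simpa using (Complex.nonneg_iff.1 h0).2.symm), rfl⟩
  -- If `f 0 = 0`, the bound `‖f t‖ ≤ f 0` forces `f = 0`; otherwise `f` can be normalized.
  by_cases hz : r = 0
  · refine ⟨0, inferInstance, fun t => ?_⟩
    have := hf.norm_le t
    rw [hr0, hz] at this
    simpa using (norm_le_zero_iff.1 (by simpa using this)).symm
  have hz' : f 0 ≠ 0 := by rw [hr]; exact_mod_cast hz
  obtain ⟨P, hP⟩ := (hf.const_mul (r := (f 0)⁻¹) (by
    rw [hr, ← Complex.ofReal_inv]; exact Complex.zero_le_real.2 (by positivity))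
    ).exists_probabilityMeasure (by fun_prop) (inv_mul_cancel₀ hz')
  refine ⟨r • (P : Measure E), inferInstance, fun t => ?_⟩
  have := hP t
  rw [charFun_apply] at this
  rw [charFun_apply, integral_smul_nnreal_measure, this, NNReal.smul_def, Complex.real_smul,
    ← hr, mul_inv_cancel_left₀ hz']

end


/-! ### Complex measures and their Jordan decompositions -/

instance isFiniteMeasure_variation {X : Type*} [MeasurableSpace X] (μ : ComplexMeasure X) :
    IsFiniteMeasure μ.variation := by
  have h : μ.variation ≤ μ.re.totalVariation + μ.im.totalVariation := by
    refine VectorMeasure.variation_le_of_forall_enorm_le fun s _ => ?_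
    calc ‖μ s‖ₑ ≤ ‖μ.re s‖ₑ + ‖μ.im s‖ₑ := by
          have hr : μ.re s = (μ s).re := rfl
          have hi : μ.im s = (μ s).im := rfl
          rw [hr, hi, ← ofReal_norm, ← ofReal_norm, ← ofReal_norm,
            ← ENNReal.ofReal_add (norm_nonneg _) (norm_nonneg _)]
          exact ENNReal.ofReal_le_ofReal (Complex.norm_le_abs_re_add_abs_im _)
      _ ≤ μ.re.totalVariation s + μ.im.totalVariation s :=
          add_le_add (SignedMeasure.enorm_le_totalVariation _ _)
            (SignedMeasure.enorm_le_totalVariation _ _)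
  have (ν : SignedMeasure X) : IsFiniteMeasure ν.totalVariation := by
    unfold SignedMeasure.totalVariation
    infer_instance
  exact isFiniteMeasure_of_le _ h

/-- The Radon condition is automatic: complex measures have finite variation, and finite Borel
measures on `ℝᵈ` are regular. -/
theorem isFiniteRadon {d : ℕ} (μ : ComplexMeasure (EuclideanSpace ℝ (Fin d))) :
    IsFiniteRadon μ :=
  ⟨inferInstance, inferInstance⟩

/-- A finite measure, seen as a complex measure. -/
noncomputable def ofMeasure {X : Type*} [MeasurableSpace X] (ν : Measure X) [IsFiniteMeasure ν] :
    ComplexMeasure X :=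
  ν.toSignedMeasure.toComplexMeasure 0

theorem ofMeasure_apply {X : Type*} [MeasurableSpace X] (ν : Measure X) [IsFiniteMeasure ν]
    {s : Set X} (hs : MeasurableSet s) : ofMeasure ν s = (ν.real s : ℂ) := by
  apply Complex.ext <;>
    simp [ofMeasure, SignedMeasure.toComplexMeasure_apply,
      Measure.toSignedMeasure_apply_measurable hs]

theorem ofMeasure_nonneg {X : Type*} [MeasurableSpace X] (ν : Measure X) [IsFiniteMeasure ν] :
    0 ≤ ofMeasure ν := fun s hs => by
  rw [ofMeasure_apply ν hs]
  exact Complex.zero_le_real.2 measureReal_nonneg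

/-- The Jordan decompositions of the real and imaginary parts of a complex measure. -/
theorem exists_eq_ofMeasure {X : Type*} [MeasurableSpace X] (μ : ComplexMeasure X) :
    ∃ (p₁ n₁ p₂ n₂ : Measure X) (_ : IsFiniteMeasure p₁) (_ : IsFiniteMeasure n₁)
      (_ : IsFiniteMeasure p₂) (_ : IsFiniteMeasure n₂),
      μ = ofMeasure p₁ - ofMeasure n₁ + Complex.I • (ofMeasure p₂ - ofMeasure n₂) := by
  refine ⟨μ.re.toJordanDecomposition.posPart, μ.re.toJordanDecomposition.negPart,
    μ.im.toJordanDecomposition.posPart, μ.im.toJordanDecomposition.negPart,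
    inferInstance, inferInstance, inferInstance, inferInstance, ?_⟩
  have h (ν : SignedMeasure X) (s : Set X) (hs : MeasurableSet s) :
      ν s = ν.toJordanDecomposition.posPart.real s - ν.toJordanDecomposition.negPart.real s := by
    conv_lhs => rw [← ν.toSignedMeasure_toJordanDecomposition]
    simp [JordanDecomposition.toSignedMeasure, Measure.toSignedMeasure_apply_measurable hs]
  ext s hs
  have h1 : (μ s).re = _ := h μ.re s hs
  have h2 : (μ s).im = _ := h μ.im s hs
  simp only [_root_.add_apply, _root_.sub_apply, _root_.smul_apply,
    ofMeasure_apply _ hs]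
  apply Complex.ext
  · simpa using h1
  · simpa using h2

/-! ### Integrals against complex measures as limits of Riemann sums -/

section Integral

variable {E : Type*} [NormedAddCommGroup E] [MeasurableSpace E] [BorelSpace E]
  [SecondCountableTopology E]

variable (E) in
/-- Finitely valued measurable maps converging pointwise to the identity. -/
noncomputable def discretize (n : ℕ) : SimpleFunc E E :=
  SimpleFunc.approxOn id measurable_id Set.univ 0 (Set.mem_univ _) n

theorem tendsto_discretize (x : E) : Tendsto (fun n => discretize E n x) atTop (𝓝 x) :=
  SimpleFunc.tendsto_approxOn _ _ (by simp)

theorem comp_discretize_eq_sum (f : E → ℂ) (n : ℕ) (x : E) : f (discretize E n x) =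
    ∑ v ∈ (discretize E n).range,
      (discretize E n ⁻¹' {v}).indicator (fun _ : E => f v) x := by
  rw [Finset.sum_eq_single (discretize E n x)]
  · simp
  · intro v _ hv
    exact Set.indicator_of_notMem (fun h => hv h.symm) _
  · intro h
    exact absurd (SimpleFunc.mem_range_self _ _) h

/-- Integrals against complex measures are limits of Riemann sums. -/
theorem tendsto_sum_vectorMeasure (μ : ComplexMeasure E) {f : E → ℂ} (hf : Continuous f) {C : ℝ}
    (hC : ∀ x, ‖f x‖ ≤ C) :
    Tendsto (fun n => ∑ v ∈ (discretize E n).range, f v * μ (discretize E n ⁻¹' {v})) atTop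
      (𝓝 (∫ᵛ x, f x ∂[ContinuousLinearMap.mul ℝ ℂ; μ])) := by
  have h : Tendsto (fun n => ∫ᵛ x, f (discretize E n x) ∂[ContinuousLinearMap.mul ℝ ℂ; μ]) atTop
      (𝓝 (∫ᵛ x, f x ∂[ContinuousLinearMap.mul ℝ ℂ; μ])) :=
    VectorMeasure.tendsto_integral_filter_of_norm_le_const
    (Eventually.of_forall fun n =>
      (hf.measurable.comp (discretize E n).measurable).aestronglyMeasurable)
    ⟨C, Eventually.of_forall fun n => ae_of_all _ fun x => hC _⟩
    (ae_of_all _ fun x => (hf.tendsto x).comp (tendsto_discretize x))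
  refine h.congr fun n => ?_
  simp_rw [comp_discretize_eq_sum f n]
  rw [VectorMeasure.integral_finsetSum]
  · refine Finset.sum_congr rfl fun v _ => ?_
    rw [VectorMeasure.integral_indicator_const _ (SimpleFunc.measurableSet_fiber _ _)]
    rfl
  · exact fun v _ => (integrable_const (μ := μ.variation) (f v)).indicator
      (SimpleFunc.measurableSet_fiber _ _)

theorem integral_ofMeasure (ν : Measure E) [IsFiniteMeasure ν] {f : E → ℂ} (hf : Continuous f)
    {C : ℝ} (hC : ∀ x, ‖f x‖ ≤ C) :
    ∫ᵛ x, f x ∂[ContinuousLinearMap.mul ℝ ℂ; ofMeasure ν] = ∫ x, f x ∂ν := by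
  refine tendsto_nhds_unique (tendsto_sum_vectorMeasure (ofMeasure ν) hf hC) ?_
  have h := tendsto_integral_of_dominated_convergence (μ := ν)
    (F := fun n x => f (discretize E n x)) (f := f) (fun _ => C)
    (fun n => (hf.measurable.comp (discretize E n).measurable).aestronglyMeasurable)
    (integrable_const C) (fun n => ae_of_all _ fun x => hC _)
    (ae_of_all _ fun x => (hf.tendsto x).comp (tendsto_discretize x))
  refine h.congr fun n => ?_
  simp_rw [comp_discretize_eq_sum f n]
  rw [integral_finsetSum]
  · refine Finset.sum_congr rfl fun v _ => ?_
    rw [integral_indicator_const _ (SimpleFunc.measurableSet_fiber _ _),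
      ofMeasure_apply _ (SimpleFunc.measurableSet_fiber _ _), Complex.real_smul, mul_comm]
  · exact fun v _ => (integrable_const (f v)).indicator (SimpleFunc.measurableSet_fiber _ _)

end Integral

/-! ### The Fourier transform of complex measures: linearity, continuity, injectivity -/

section Fourier

variable {d : ℕ}

/-- The kernel `exp(-2πi ξᵀz)` of the Fourier transform. -/
noncomputable def fourierKernel (z ξ : EuclideanSpace ℝ (Fin d)) : ℂ :=
  Complex.exp (-(2 * (π : ℂ) * Complex.I * ((inner ℝ ξ z : ℝ) : ℂ)))

theorem continuous_fourierKernel (z : EuclideanSpace ℝ (Fin d)) : Continuous (fourierKernel z) := by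
  unfold fourierKernel
  fun_prop

theorem norm_fourierKernel (z ξ : EuclideanSpace ℝ (Fin d)) : ‖fourierKernel z ξ‖ = 1 := by
  simp [fourierKernel, Complex.norm_exp]

theorem fourierKernel_sub (x y ξ : EuclideanSpace ℝ (Fin d)) :
    fourierKernel (x - y) ξ = fourierKernel x ξ * conj (fourierKernel y ξ) := by
  simp only [fourierKernel, ← Complex.exp_conj, ← Complex.exp_add, inner_sub_right]
  congr 1
  simp only [map_neg, map_mul, Complex.conj_ofReal, Complex.conj_I, Complex.conj_ofNat]
  push_cast
  ring

theorem tendsto_fourierTransform (μ : ComplexMeasure (EuclideanSpace ℝ (Fin d)))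
    (z : EuclideanSpace ℝ (Fin d)) :
    Tendsto (fun n => ∑ v ∈ (discretize (EuclideanSpace ℝ (Fin d)) n).range, fourierKernel z v *
      μ (discretize (EuclideanSpace ℝ (Fin d)) n ⁻¹' {v})) atTop (𝓝 (fourierTransform μ z)) :=
  tendsto_sum_vectorMeasure μ (continuous_fourierKernel z) fun ξ => (norm_fourierKernel z ξ).le

theorem fourierTransform_add (μ ν : ComplexMeasure (EuclideanSpace ℝ (Fin d)))
    (z : EuclideanSpace ℝ (Fin d)) :
    fourierTransform (μ + ν) z = fourierTransform μ z + fourierTransform ν z := by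
  refine tendsto_nhds_unique (tendsto_fourierTransform (μ + ν) z)
    (((tendsto_fourierTransform μ z).add (tendsto_fourierTransform ν z)).congr fun n => ?_)
  simp [← Finset.sum_add_distrib, mul_add]

theorem fourierTransform_smul (c : ℂ) (μ : ComplexMeasure (EuclideanSpace ℝ (Fin d)))
    (z : EuclideanSpace ℝ (Fin d)) :
    fourierTransform (c • μ) z = c * fourierTransform μ z := by
  refine tendsto_nhds_unique (tendsto_fourierTransform (c • μ) z)
    (((tendsto_fourierTransform μ z).const_mul c).congr fun n => ?_)
  simp only [Finset.mul_sum, _root_.smul_apply, smul_eq_mul]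
  exact Finset.sum_congr rfl fun v _ => by ring

/-- The Fourier transform as a linear map. -/
noncomputable def fourierTransformₗ (z : EuclideanSpace ℝ (Fin d)) :
    ComplexMeasure (EuclideanSpace ℝ (Fin d)) →ₗ[ℂ] ℂ where
  toFun μ := fourierTransform μ z
  map_add' μ ν := fourierTransform_add μ ν z
  map_smul' c μ := fourierTransform_smul c μ z

theorem fourierTransformₗ_apply (z : EuclideanSpace ℝ (Fin d))
    (μ : ComplexMeasure (EuclideanSpace ℝ (Fin d))) :
    fourierTransformₗ z μ = fourierTransform μ z := rfl

theorem fourierTransform_ofMeasure (ν : Measure (EuclideanSpace ℝ (Fin d))) [IsFiniteMeasure ν]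
    (z : EuclideanSpace ℝ (Fin d)) :
    fourierTransform (ofMeasure ν) z = charFun ν (-(2 * π) • z) := by
  refine (integral_ofMeasure ν (continuous_fourierKernel z)
    fun ξ => (norm_fourierKernel z ξ).le).trans ?_
  rw [charFun_apply]
  congr with ξ
  rw [fourierKernel, inner_smul_right]
  congr 1
  push_cast
  ring

theorem continuous_fourierTransform (μ : ComplexMeasure (EuclideanSpace ℝ (Fin d))) :
    Continuous (fourierTransform μ) := by
  have h : Continuous fun z => ∫ᵛ ξ, fourierKernel z ξ ∂[ContinuousLinearMap.mul ℝ ℂ; μ] := by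
    refine VectorMeasure.continuous_of_dominated (bound := fun _ => 1)
      (fun z => (continuous_fourierKernel z).aestronglyMeasurable)
      (fun z => ae_of_all _ fun ξ => (norm_fourierKernel z ξ).le) (integrable_const _)
      (ae_of_all _ fun ξ => ?_)
    unfold fourierKernel
    fun_prop
  exact h

theorem eq_zero_of_fourierTransform_eq_zero {μ : ComplexMeasure (EuclideanSpace ℝ (Fin d))}
    (h : ∀ z, fourierTransform μ z = 0) : μ = 0 := by
  obtain ⟨p₁, n₁, p₂, n₂, _, _, _, _, rfl⟩ := exists_eq_ofMeasure μ
  have key (t : EuclideanSpace ℝ (Fin d)) :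
      charFun p₁ t - charFun n₁ t + Complex.I * (charFun p₂ t - charFun n₂ t) = 0 := by
    have := h (-(2 * π)⁻¹ • t)
    rw [← fourierTransformₗ_apply, map_add, map_sub, map_smul, map_sub] at this
    simp only [fourierTransformₗ_apply, fourierTransform_ofMeasure, smul_smul] at this
    rwa [neg_mul_neg, mul_inv_cancel₀ (by positivity), one_smul] at this
  -- Characteristic functions of positive measures satisfy `φ(-t) = conj φ(t)`, so conjugating `key
  -- (-t)` only flips the sign of `i`. This separates the real and imaginary parts of the measure.
  have key' (t : EuclideanSpace ℝ (Fin d)) :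
      charFun p₁ t - charFun n₁ t - Complex.I * (charFun p₂ t - charFun n₂ t) = 0 := by
    have := congrArg conj (key (-t))
    simp only [charFun_neg, map_add, map_sub, map_mul, Complex.conj_conj, Complex.conj_I,
      map_zero] at this
    linear_combination this
  have h1 : p₁ = n₁ := Measure.ext_of_charFun <| funext fun t => by
    linear_combination (key t + key' t) / 2
  have h2 : p₂ = n₂ := Measure.ext_of_charFun <| funext fun t => by
    linear_combination (-Complex.I) * (key t - key' t) / 2 +
      (charFun p₂ t - charFun n₂ t) * Complex.I_mul_I
  subst h1 h2
  simp

theorem eq_of_fourierTransform_eq {μ ν : ComplexMeasure (EuclideanSpace ℝ (Fin d))}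
    (h : ∀ z, fourierTransform μ z = fourierTransform ν z) : μ = ν := by
  rw [← sub_eq_zero]
  refine eq_zero_of_fourierTransform_eq_zero fun z => ?_
  rw [← fourierTransformₗ_apply, map_sub, fourierTransformₗ_apply, fourierTransformₗ_apply, h,
    sub_self]

/-- **Bochner's theorem** for the Fourier transform of complex measures. -/
theorem PositiveDefinite.exists_fourierTransform_eq {f : EuclideanSpace ℝ (Fin d) → ℂ}
    (hf : PositiveDefinite f) (hc : Continuous f) :
    ∃ μ : ComplexMeasure (EuclideanSpace ℝ (Fin d)), 0 ≤ μ ∧ ∀ z, fourierTransform μ z = f z := by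
  obtain ⟨ν, _, h⟩ := (hf.comp_addMonoidHom (DistribSMul.toAddMonoidHom
    (EuclideanSpace ℝ (Fin d)) (-(2 * π)⁻¹))).exists_charFun_eq (by simp; fun_prop)
  refine ⟨ofMeasure ν, ofMeasure_nonneg ν, fun z => ?_⟩
  rw [fourierTransform_ofMeasure, h]
  simp only [DistribSMul.toAddMonoidHom_apply, smul_smul]
  rw [neg_mul_neg, inv_mul_cancel₀ (by positivity), one_smul]

end Fourier


/-! ### Positive semidefinite kernels and the two implications -/

theorem sum_smul_apply {X : Type*} [MeasurableSpace X] {n : ℕ} (c : Fin n → Fin n → ℂ)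
    (μ : Fin n → Fin n → ComplexMeasure X) (s : Set X) :
    (∑ k, ∑ l, c k l • μ k l) s = ∑ k, ∑ l, c k l * μ k l s := by
  simp

/-- A real kernel is symmetric and positive semidefinite if and only if all its finite quadratic
forms with complex coefficients are nonnegative. -/
theorem posSemidef_iff_complex {U : Type*} (K : Matrix U U ℝ) :
    K.PosSemidef ↔ ∀ (n : ℕ) (u : Fin n → U) (c : Fin n → ℂ),
      0 ≤ ∑ i, ∑ j, c i * conj (c j) * (K (u i) (u j) : ℂ) := by
  constructor
  · intro hK n u c
    have hsymm (i j : Fin n) : K (u i) (u j) = K (u j) (u i) := by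
      simpa using hK.1.apply (u j) (u i)
    have hreal (a : Fin n → ℝ) : 0 ≤ ∑ i, ∑ j, a i * a j * K (u i) (u j) := by
      have := (hK.submatrix u).dotProduct_mulVec_nonneg a
      simp only [dotProduct, Matrix.mulVec, Matrix.submatrix_apply, star_trivial, Finset.mul_sum,
        Pi.star_apply] at this
      refine this.trans_eq (Finset.sum_congr rfl fun i _ => Finset.sum_congr rfl fun j _ => ?_)
      ring
    -- An antisymmetric coefficient is paired with a symmetric kernel.
    have him : ∑ i, ∑ j, ((c i).im * (c j).re - (c i).re * (c j).im) * K (u i) (u j) = 0 := by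
      have : ∑ i, ∑ j, ((c i).im * (c j).re - (c i).re * (c j).im) * K (u i) (u j) =
          -∑ i, ∑ j, ((c i).im * (c j).re - (c i).re * (c j).im) * K (u i) (u j) := by
        conv_lhs => rw [Finset.sum_comm]
        simp only [← Finset.sum_neg_distrib]
        refine Finset.sum_congr rfl fun i _ => Finset.sum_congr rfl fun j _ => ?_
        rw [hsymm j i]
        ring
      linarith
    have e : ∑ i, ∑ j, c i * conj (c j) * (K (u i) (u j) : ℂ) =
        ((∑ i, ∑ j, (c i).re * (c j).re * K (u i) (u j) +
          ∑ i, ∑ j, (c i).im * (c j).im * K (u i) (u j) : ℝ) : ℂ) := by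
      apply Complex.ext
      · simp only [Complex.re_sum, Complex.ofReal_re, ← Finset.sum_add_distrib]
        refine Finset.sum_congr rfl fun i _ => Finset.sum_congr rfl fun j _ => ?_
        simp only [Complex.mul_re, Complex.mul_im, Complex.conj_re, Complex.conj_im,
          Complex.ofReal_re, Complex.ofReal_im]
        ring
      · rw [Complex.ofReal_im, ← him]
        simp only [Complex.im_sum]
        refine Finset.sum_congr rfl fun i _ => Finset.sum_congr rfl fun j _ => ?_
        simp only [Complex.mul_re, Complex.mul_im, Complex.conj_re, Complex.conj_im,
          Complex.ofReal_re, Complex.ofReal_im]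
        ring
    rw [e]
    exact Complex.zero_le_real.2 (add_nonneg (hreal _) (hreal _))
  · intro h
    constructor
    · ext p q
      -- With coefficients `1, i`, the imaginary part is `K q p - K p q` up to diagonal terms, which
      -- are real.
      have := (Complex.nonneg_iff.1 (h 2 ![p, q] ![1, Complex.I])).2
      simp [Fin.sum_univ_two] at this
      simp only [Matrix.conjTranspose_apply, star_trivial]
      linarith
    · intro x
      set e := x.support.equivFin
      have := h x.support.card (fun i => e.symm i) fun i => (x (e.symm i) : ℂ)
      have e1 : x.sum (fun i xi => x.sum fun j xj => star xi * K i j * xj) =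
          ∑ i, ∑ j, x (e.symm i) * x (e.symm j) * K (e.symm i) (e.symm j) := by
        simp only [Finsupp.sum, star_trivial]
        rw [← Finset.sum_coe_sort, ← e.symm.sum_comp]
        refine Finset.sum_congr rfl fun i _ => ?_
        rw [← Finset.sum_coe_sort, ← e.symm.sum_comp]
        exact Finset.sum_congr rfl fun j _ => by ring
      rw [e1]
      simp only [Complex.conj_ofReal] at this
      exact_mod_cast this

variable {S : Type*} {d : ℕ}

/-- On a cell with tag `v`, the Riemann sum is the positive measure with coefficients `cᵢ e^{-2πi
vᵀxᵢ}` evaluated at that cell. -/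
theorem IsPositiveMeasureKernel.sum_fourierTransform_nonneg
    {μ : S → S → ComplexMeasure (EuclideanSpace ℝ (Fin d))} (hμ : IsPositiveMeasureKernel μ)
    (n : ℕ) (u : Fin n → S × EuclideanSpace ℝ (Fin d)) (c : Fin n → ℂ) :
    0 ≤ ∑ i, ∑ j, c i * conj (c j) *
      fourierTransform (μ (u i).1 (u j).1) ((u i).2 - (u j).2) := by
  have hlim := tendsto_finsetSum Finset.univ fun (i : Fin n) _ =>
    tendsto_finsetSum Finset.univ fun (j : Fin n) _ =>
      (tendsto_fourierTransform (μ (u i).1 (u j).1) ((u i).2 - (u j).2)).const_mul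
        (c i * conj (c j))
  refine ge_of_tendsto hlim (Eventually.of_forall fun m => ?_)
  simp only [Finset.mul_sum]
  simp_rw [Finset.sum_comm (s := Finset.univ)
    (t := (discretize (EuclideanSpace ℝ (Fin d)) m).range)]
  refine Finset.sum_nonneg fun v _ => ?_
  have h := hμ n (fun i => (u i).1) (fun i => c i * fourierKernel (u i).2 v) _
    (SimpleFunc.measurableSet_fiber (discretize (EuclideanSpace ℝ (Fin d)) m) v)
  rw [sum_smul_apply] at h
  refine h.trans_eq (Finset.sum_congr rfl fun i _ => Finset.sum_congr rfl fun j _ => ?_)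
  rw [fourierKernel_sub, map_mul]
  ring

section Construction

variable {Γ : S → S → EuclideanSpace ℝ (Fin d) → ℝ}

/-- This is the form of the kernel at the `m * n` points `(sₖ, xᵢ)` with coefficients `cᵢ aₖ`. -/
theorem positiveDefinite_sum_of_posSemidef (hK : (kernel Γ).PosSemidef) {n : ℕ} (s : Fin n → S)
    (a : Fin n → ℂ) :
    PositiveDefinite fun z => ∑ k, ∑ l, a k * conj (a l) * (Γ (s k) (s l) z : ℂ) := by
  intro m x c
  have h := (posSemidef_iff_complex _).1 hK (m * n)
    (fun p => (s (finProdFinEquiv.symm p).2, x (finProdFinEquiv.symm p).1))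
    (fun p => c (finProdFinEquiv.symm p).1 * a (finProdFinEquiv.symm p).2)
  rw [← finProdFinEquiv.sum_comp] at h
  simp_rw [← finProdFinEquiv.sum_comp (fun p : Fin (m * n) => _ * conj (_ * _) * _),
    Equiv.symm_apply_apply, Fintype.sum_prod_type] at h
  refine h.trans_eq (Finset.sum_congr rfl fun i _ => ?_)
  rw [Finset.sum_comm]
  refine Finset.sum_congr rfl fun j _ => ?_
  simp only [Finset.mul_sum]
  refine Finset.sum_congr rfl fun k _ => Finset.sum_congr rfl fun l _ => ?_
  simp only [kernel, Matrix.of_apply, map_mul]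
  ring

theorem exists_positive_fourierTransform_eq_sum (hc : ∀ s₁ s₂, Continuous (Γ s₁ s₂))
    (hK : (kernel Γ).PosSemidef) {n : ℕ} (s : Fin n → S) (a : Fin n → ℂ) :
    ∃ μ : ComplexMeasure (EuclideanSpace ℝ (Fin d)), 0 ≤ μ ∧
      ∀ z, fourierTransform μ z = ∑ k, ∑ l, a k * conj (a l) * (Γ (s k) (s l) z : ℂ) :=
  (positiveDefinite_sum_of_posSemidef hK s a).exists_fourierTransform_eq
    (continuous_finsetSum _ fun _ _ => continuous_finsetSum _ fun _ _ =>
      continuous_const.mul (Complex.continuous_ofReal.comp (hc _ _)))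

theorem exists_fourierTransform_eq_of_posSemidef (hc : ∀ s₁ s₂, Continuous (Γ s₁ s₂))
    (hK : (kernel Γ).PosSemidef) (s₁ s₂ : S) :
    ∃ μ : ComplexMeasure (EuclideanSpace ℝ (Fin d)),
      ∀ z, (Γ s₁ s₂ z : ℂ) = fourierTransform μ z := by
  choose M _ hM using fun b : ℂ =>
    exists_positive_fourierTransform_eq_sum hc hK ![s₁, s₂] ![1, b]
  -- Polarization: `M b` represents `Γ₁₁ + b̄ Γ₁₂ + b Γ₂₁ + |b|² Γ₂₂`, and averaging `b • M b` over
  -- the fourth roots of unity keeps only `Γ₁₂`.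
  refine ⟨(4⁻¹ : ℂ) • (M 1 + Complex.I • M Complex.I - M (-1) - Complex.I • M (-Complex.I)),
    fun z => ?_⟩
  rw [← fourierTransformₗ_apply]
  simp only [map_smul, map_add, map_sub, fourierTransformₗ_apply, hM, smul_eq_mul]
  simp [Fin.sum_univ_two]
  ring_nf
  simp
  ring

end Construction

end BochnerPlus

theorem mainTheorem2 {S : Type*} {d : ℕ} (Γ : S → S → EuclideanSpace ℝ (Fin d) → ℝ) :
    ((∀ s₁ s₂ : S, Continuous (Γ s₁ s₂)) ∧ (BochnerPlus.kernel Γ).PosSemidef) ↔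
      ∃ μ : S → S → ComplexMeasure (EuclideanSpace ℝ (Fin d)),
        (∀ s₁ s₂ : S, BochnerPlus.IsFiniteRadon (μ s₁ s₂)) ∧
        (∀ (s₁ s₂ : S) (z : EuclideanSpace ℝ (Fin d)),
          (Γ s₁ s₂ z : ℂ) = BochnerPlus.fourierTransform (μ s₁ s₂) z) ∧
        BochnerPlus.IsPositiveMeasureKernel μ := by
  constructor
  · rintro ⟨hc, hK⟩
    choose μ hμ using BochnerPlus.exists_fourierTransform_eq_of_posSemidef hc hK
    refine ⟨μ, fun _ _ => BochnerPlus.isFiniteRadon _, hμ, fun n s a => ?_⟩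
    obtain ⟨ν, hν, h⟩ := BochnerPlus.exists_positive_fourierTransform_eq_sum hc hK s a
    suffices e : ∑ k, ∑ l, (a k * conj (a l)) • μ (s k) (s l) = ν by rwa [e]
    -- The measures were chosen separately for each pair; injectivity of the Fourier transform makes
    -- them compatible.
    refine BochnerPlus.eq_of_fourierTransform_eq fun z => ?_
    rw [h, ← BochnerPlus.fourierTransformₗ_apply]
    simp only [map_sum, map_smul, BochnerPlus.fourierTransformₗ_apply, ← hμ, smul_eq_mul]
  · rintro ⟨μ, -, hμ, hpos⟩
    refine ⟨fun s₁ s₂ => ?_, (BochnerPlus.posSemidef_iff_complex _).2 fun n u c => ?_⟩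
    · have h : Γ s₁ s₂ = fun z => (BochnerPlus.fourierTransform (μ s₁ s₂) z).re := by
        ext z
        rw [← hμ, Complex.ofReal_re]
      rw [h]
      exact Complex.continuous_re.comp (BochnerPlus.continuous_fourierTransform _)
    · simpa only [BochnerPlus.kernel, Matrix.of_apply, hμ] using
        hpos.sum_fourierTransform_nonneg n u c
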